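/- Let $m\ge 2$, let $\mathfrak S_n$ denote the symmetric group on $n$ letters with simple transpositions $s_i=(i,i+1)$ and length function $\ell$, and multiply permutations from right to left. A Coxeter element of $\mathfrak S_n$ is a product of the $n-1$ simple transpositions, each used once, in some order. For $n \ge 2$, the height of a Coxeter element $C$ of $\mathfrak S_n=\langle s_1,\dots,s_{n-1}\rangle$ is $ht(C)=\sum_{i=2}^{n-1}\epsilon_i$, where $\epsilon_i=+1$ if $s_i$ stands to the left of $s_{i-1}$ in such a product for $C$ and $\epsilon_i=-1$ otherwise (this does not depend on the chosen product). Regard $\mathfrak S_{n+2}$ as the permutations of $\{0,1,\dots,n+1\}$, generated by $s_0,\dots,s_n$, and $\mathfrak S_n$ as the subgroup fixing $0$ and $n+1$. The extensions of a Coxeter element $C\in\mathfrak S_n$ are the Coxeter elements $s_0s_nC$, $Cs_0s_n$, $s_0Cs_n$ and $s_nCs_0$ of $\mathfrak S_{n+2}$. A Coxeter element of $\mathfrak S_{2m-1}$ is admissible if it is obtained from $s_1s_2$ or $s_2s_1$ in $\mathfrak S_3$ by repeated extensions (possibly none), where every extension produced has height of absolute value at most $1$. Let $C$ be a Coxeter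 element of $\mathfrak S_{2m-1}$. Then $C$ is admissible if and only if there are $w_1,w_2\in\mathfrak S_{2m-1}$ with $C=w_1w_2$ and $\ell(w_1)=\ell(w_2)=m-1$ such that $w_2C^{m-1}$ is the longest element of $\mathfrak S_{2m-1}$. -/

import Mathlib

open Equiv

namespace CoxeterAdmissible

/-- The simple transposition of `𝔖_n` that exchanges the letters `i` and `i + 1`, where the
`n` letters are `0, 1, …, n - 1` and `i` runs over `0, …, n - 2`. -/
def simple {n : ℕ} (i : Fin (n - 1)) : Perm (Fin n) :=
  Equiv.swap ⟨i.val, by omega⟩ ⟨i.val + 1, by omega⟩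

/-- The element of `𝔖_n` represented by a word in the simple transpositions. Products compose
from right to left. -/
def wordProd {n : ℕ} (l : List (Fin (n - 1))) : Perm (Fin n) := (l.map simple).prod

/-- The length of `w`: the least number of letters of a word representing `w`. -/
noncomputable def length {n : ℕ} (w : Perm (Fin n)) : ℕ :=
  sInf {r : ℕ | ∃ l : List (Fin (n - 1)), wordProd l = w ∧ l.length = r}

/-- `w` is the longest element: no element has a larger length. -/
def IsLongest {n : ℕ} (w : Perm (Fin n)) : Prop := ∀ v : Perm (Fin n), length v ≤ length w

/-- The word `l` uses each of the `n - 1` simple transpositions exactly once and represents `C`. -/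
def IsCoxeterWord {n : ℕ} (l : List (Fin (n - 1))) (C : Perm (Fin n)) : Prop :=
  l.Nodup ∧ (∀ i, i ∈ l) ∧ wordProd l = C

/-- Coxeter elements: products of the `n - 1` distinct simple transpositions in some order. -/
def IsCoxeterElement {n : ℕ} (C : Perm (Fin n)) : Prop :=
  ∃ l : List (Fin (n - 1)), IsCoxeterWord l C

/-- The Coxeter path read off a word. Its entries are attached to the inner letters `k + 1` of
`0, …, n - 1`; the entry is `+1` if the transposition to the right of that letter stands to the left
of (in a diagram: higher than) the transposition to the left of that letter, and `-1` otherwise. -/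
def pathOfWord {n : ℕ} (l : List (Fin (n - 1))) (k : Fin (n - 2)) : ℤ :=
  if l.idxOf ⟨k.val + 1, by omega⟩ < l.idxOf ⟨k.val, by omega⟩ then 1 else -1

open Classical in
/-- The Coxeter path of a Coxeter element, computed from any word that uses every simple
transposition once (see `path_eq` for the independence of that word). -/
noncomputable def path {n : ℕ} (C : Perm (Fin n)) : Fin (n - 2) → ℤ :=
  if h : IsCoxeterElement C then pathOfWord h.choose else 0

/-- The height of a Coxeter element: the sum of the entries of its Coxeter path. -/
noncomputable def height {n : ℕ} (C : Perm (Fin n)) : ℤ := ∑ k, path C k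

/-- The embedding of `𝔖_n` in `𝔖_{n+2}` that shifts the letters by one and fixes the new first and
last letters. -/
noncomputable def bar {n : ℕ} (w : Perm (Fin n)) : Perm (Fin (n + 2)) :=
  w.viaEmbedding (Fin.castSuccEmb.trans (Fin.succEmb (n + 1)))

/-- The leftmost simple transposition of `𝔖_{n+2}`. -/
def leftGen (n : ℕ) : Perm (Fin (n + 2)) := simple (n := n + 2) ⟨0, by omega⟩

/-- The rightmost simple transposition of `𝔖_{n+2}`. -/
def rightGen (n : ℕ) : Perm (Fin (n + 2)) := simple (n := n + 2) ⟨n, by omega⟩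

/-- `D` is one of the four extensions of `C`. -/
def IsExtension {n : ℕ} (C : Perm (Fin n)) (D : Perm (Fin (n + 2))) : Prop :=
  D = leftGen n * rightGen n * bar C ∨ D = bar C * leftGen n * rightGen n ∨
    D = leftGen n * bar C * rightGen n ∨ D = rightGen n * bar C * leftGen n

/-- Admissible Coxeter elements: those obtained from the two Coxeter elements of `𝔖_3` by iterated
extensions whose results all have height of absolute value at most `1`. -/
inductive IsAdmissible : {n : ℕ} → Perm (Fin n) → Prop
  | base_left : IsAdmissible (simple (n := 3) 0 * simple (n := 3) 1)
  | base_right : IsAdmissible (simple (n := 3) 1 * simple (n := 3) 0)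
  | extension {n : ℕ} {C : Perm (Fin n)} {D : Perm (Fin (n + 2))} (hC : IsAdmissible C)
      (hD : IsExtension C D) (hht : |height D| ≤ 1) : IsAdmissible D

/-! Every element has a word, and the Coxeter path does not depend on the word. -/

theorem exists_word {n : ℕ} (w : Perm (Fin n)) : ∃ l, wordProd l = w := by
  obtain _ | n := n
  · exact ⟨[], Subsingleton.elim _ _⟩
  have h := Equiv.Perm.mclosure_swap_castSucc_succ n
  have hw : w ∈ Submonoid.closure (Set.range fun i : Fin n ↦ Equiv.swap i.castSucc i.succ) := by
    rw [h]; trivial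
  induction hw using Submonoid.closure_induction with
  | mem x hx =>
    obtain ⟨i, rfl⟩ := hx
    exact ⟨[i], by simp only [wordProd, List.map_cons, List.map_nil, List.prod_singleton]; rfl⟩
  | one => exact ⟨[], rfl⟩
  | mul x y _ _ hx hy =>
    obtain ⟨a, rfl⟩ := hx
    obtain ⟨b, rfl⟩ := hy
    exact ⟨a ++ b, by simp [wordProd]⟩

theorem wordProd_cons_inv {n : ℕ} (a : Fin (n - 1)) (l : List (Fin (n - 1))) (x : Fin n) :
    (wordProd (a :: l))⁻¹ x = (wordProd l)⁻¹ (simple a x) := by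
  simp [wordProd, mul_inv_rev, simple]

theorem simple_val {n : ℕ} (a : Fin (n - 1)) (x : Fin n) :
    (simple a x).val = if x.val = a.val then a.val + 1 else if x.val = a.val + 1 then a.val
      else x.val := by
  simp only [simple, Equiv.swap_apply_def, Fin.ext_iff]
  split_ifs <;> rfl

theorem inv_wordProd_side {n : ℕ} (j : Fin (n - 1)) (l : List (Fin (n - 1))) (hj : j ∉ l)
    (x : Fin n) : ((wordProd l)⁻¹ x).val ≤ j.val ↔ x.val ≤ j.val := by
  induction l generalizing x with
  | nil => simp [wordProd]
  | cons a l ih =>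
    rw [List.mem_cons, not_or] at hj
    have hne : j.val ≠ a.val := fun h => hj.1 (Fin.ext h)
    rw [wordProd_cons_inv, ih hj.2, simple_val]
    split_ifs <;> omega

theorem idxOf_lt_iff {n : ℕ} (k : Fin (n - 2)) (l : List (Fin (n - 1))) (hl : l.Nodup)
    (h0 : (⟨k.val, by omega⟩ : Fin (n - 1)) ∈ l) (h1 : (⟨k.val + 1, by omega⟩ : Fin (n - 1)) ∈ l) :
    l.idxOf ⟨k.val + 1, by omega⟩ < l.idxOf ⟨k.val, by omega⟩ ↔
      k.val + 1 < ((wordProd l)⁻¹ ⟨k.val + 1, by omega⟩).val := by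
  induction l with
  | nil => simp at h0
  | cons a l ih =>
    rw [List.nodup_cons] at hl
    rw [wordProd_cons_inv]
    by_cases ha1 : a = ⟨k.val + 1, by omega⟩
    · subst ha1
      have := inv_wordProd_side _ l hl.1 (simple ⟨k.val + 1, by omega⟩ ⟨k.val + 1, by omega⟩)
      rw [simple_val] at this
      simp only [if_true] at this
      rw [List.idxOf_cons_self, List.idxOf_cons_ne _ (by simp [Fin.ext_iff])]
      constructor
      · intro _; omega
      · intro _; omega
    · by_cases ha0 : a = ⟨k.val, by omega⟩
      · subst ha0
        have := inv_wordProd_side _ l hl.1 (simple ⟨k.val, by omega⟩ ⟨k.val + 1, by omega⟩)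
        rw [simple_val] at this
        rw [if_neg (by simp), if_pos rfl] at this
        simp only [le_refl, iff_true] at this
        rw [List.idxOf_cons_self]
        constructor
        · intro h; omega
        · intro h; omega
      · have hs : simple a ⟨k.val + 1, by omega⟩ = (⟨k.val + 1, by omega⟩ : Fin n) := by
          apply Fin.ext
          rw [Fin.ext_iff] at ha0 ha1
          rw [simple_val]
          simp only at *
          split_ifs <;> omega
        rw [hs, ← ih hl.2 ((List.mem_cons.1 h0).resolve_left (Ne.symm ha0))
          ((List.mem_cons.1 h1).resolve_left (Ne.symm ha1)), List.idxOf_cons_ne _ ha0,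
          List.idxOf_cons_ne _ ha1]
        omega

theorem path_eq {n : ℕ} {C : Perm (Fin n)} {l : List (Fin (n - 1))} (h : IsCoxeterWord l C) :
    path C = pathOfWord l := by
  have hC : IsCoxeterElement C := ⟨l, h⟩
  obtain ⟨h1, h2, h3⟩ := hC.choose_spec
  funext k
  rw [path, dif_pos hC, pathOfWord, pathOfWord]
  congr 1
  rw [idxOf_lt_iff k _ h1 (h2 _) (h2 _), idxOf_lt_iff k l h.1 (h.2.1 _) (h.2.1 _), h3, h.2.2]

end CoxeterAdmissible

/-! Write `w₀` for the longest element, which is the reversal of the letters; conjugation by it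
sends each simple transposition to its mirror image. Both sides of the equivalence say that `C` has
a word `mirror l ++ l` using every generator exactly once, that is, `C = double l` for a half word
`l`.

For the factorization (`exists_factorization_iff`), put `σ = w₀ w₂`. Since `C` is a cycle of length
`2m - 1`, the condition `w₂ C^(m-1) = w₀` says `σ = C^m`, the square root of `C` among its powers.
Then `C = σ²` forces `w₁ = w₀ w₂ w₀`, and reduced words of `w₂` are the half words. Conversely, any
`σ` with `σ² = C` centralizes the full cycle `C`, hence is a power of it, hence is `C^m`.

For admissibility, the path of `double l` is antisymmetric up to a telescoping term, so its height
is `±1` (`IsHalfWord.height_double`). Inserting an outer generator into a half word gives an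
extension (`isExtension_double`), so every `double l` is built from rank two with all heights
bounded. Conversely, three of the four extensions of `double l` are again doubles, and the fourth
has height `±3` (`IsAdmissible.exists_halfWord`). -/

namespace CoxeterAdmissible

/-! ### Length as the number of inversions; the longest element -/

/-- The set of inversions of a permutation, as pairs of positions. -/
def inversions {n : ℕ} (w : Perm (Fin n)) : Finset (Fin n × Fin n) :=
  Finset.univ.filter fun p => p.1 < p.2 ∧ w p.2 < w p.1

theorem mem_inversions {n : ℕ} {w : Perm (Fin n)} {p : Fin n × Fin n} :
    p ∈ inversions w ↔ p.1 < p.2 ∧ w p.2 < w p.1 := by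
  simp [inversions]

theorem simple_mul_self {n : ℕ} (a : Fin (n - 1)) : simple a * simple a = 1 := by
  simp [simple]

theorem simple_simple {n : ℕ} (a : Fin (n - 1)) (x : Fin n) : simple a (simple a x) = x := by
  simp [simple]

theorem simple_lt_simple {n : ℕ} (a : Fin (n - 1)) {i j : Fin n} (h : i < j)
    (hne : ¬ (i.val = a.val ∧ j.val = a.val + 1)) : simple a i < simple a j := by
  rw [Fin.lt_def] at h ⊢
  rw [simple_val, simple_val]
  split_ifs <;> omega

/-- Applying `simple a` to both positions matches the old inversions with the new ones, except for
the pair `(a, a + 1)`, the only pair whose order it reverses. -/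
theorem card_inversions_mul_simple {n : ℕ} (w : Perm (Fin n)) (a : Fin (n - 1))
    (h : w ⟨a.val, by omega⟩ < w ⟨a.val + 1, by omega⟩) :
    (inversions (w * simple a)).card = (inversions w).card + 1 := by
  have hl : simple a (⟨a.val, by omega⟩ : Fin n) = ⟨a.val + 1, by omega⟩ := by simp [simple]
  have hr : simple a (⟨a.val + 1, by omega⟩ : Fin n) = ⟨a.val, by omega⟩ := by simp [simple]
  have key : inversions (w * simple a) =
      insert (⟨a.val, by omega⟩, ⟨a.val + 1, by omega⟩)
        ((inversions w).map ((simple a).prodCongr (simple a)).toEmbedding) := by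
    ext ⟨i, j⟩
    rw [Finset.mem_insert, Finset.mem_map_equiv, mem_inversions, mem_inversions]
    have hs : (simple a).symm = simple a := by simp [simple]
    simp only [Equiv.prodCongr_symm, Equiv.prodCongr_apply, Prod.map, hs, Perm.mul_apply,
      Prod.mk.injEq]
    constructor
    · rintro ⟨h1, h2⟩
      by_cases hc : i.val = a.val ∧ j.val = a.val + 1
      · left; exact ⟨Fin.ext hc.1, Fin.ext hc.2⟩
      · right; exact ⟨simple_lt_simple a h1 hc, h2⟩
    · rintro (⟨rfl, rfl⟩ | ⟨h1, h2⟩)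
      · refine ⟨by simp [Fin.lt_def], ?_⟩
        rw [hl, hr]; exact h
      · refine ⟨?_, h2⟩
        by_cases hc : (simple a i).val = a.val ∧ (simple a j).val = a.val + 1
        · exfalso
          have e1 : simple a i = ⟨a.val, by omega⟩ := Fin.ext hc.1
          have e2 : simple a j = ⟨a.val + 1, by omega⟩ := Fin.ext hc.2
          rw [e1, e2] at h2
          exact absurd h2 (not_lt.2 h.le)
        · simpa only [simple_simple] using simple_lt_simple a h1 hc
  rw [key, Finset.card_insert_of_notMem, Finset.card_map]
  rw [Finset.mem_map_equiv, mem_inversions]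
  have hs : (simple a).symm = simple a := by simp [simple]
  simp only [Equiv.prodCongr_symm, Equiv.prodCongr_apply, Prod.map, hs, hl, hr]
  rintro ⟨h1, -⟩
  rw [Fin.lt_def] at h1
  simp only at h1
  omega

theorem card_inversions_mul_simple_of_gt {n : ℕ} (w : Perm (Fin n)) (a : Fin (n - 1))
    (h : w ⟨a.val + 1, by omega⟩ < w ⟨a.val, by omega⟩) :
    (inversions w).card = (inversions (w * simple a)).card + 1 := by
  have := card_inversions_mul_simple (w * simple a) a (by simpa [simple] using h)
  rwa [mul_assoc, simple_mul_self, mul_one] at this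

theorem wordProd_append {n : ℕ} (l l' : List (Fin (n - 1))) :
    wordProd (l ++ l') = wordProd l * wordProd l' := by
  simp [wordProd]

theorem wordProd_cons {n : ℕ} (a : Fin (n - 1)) (l : List (Fin (n - 1))) :
    wordProd (a :: l) = simple a * wordProd l := by
  simp [wordProd]

theorem wordProd_singleton {n : ℕ} (a : Fin (n - 1)) : wordProd [a] = simple a := by
  simp [wordProd]

theorem card_inversions_wordProd_le {n : ℕ} (l : List (Fin (n - 1))) :
    (inversions (wordProd l)).card ≤ l.length := by
  induction l using List.reverseRecOn with
  | nil =>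
    simp only [List.length_nil, Nat.le_zero, Finset.card_eq_zero, Finset.eq_empty_iff_forall_notMem,
      mem_inversions]
    rintro ⟨i, j⟩ ⟨h1, h2⟩
    exact absurd h1 (not_lt.2 (le_of_lt (by simpa [wordProd] using h2)))
  | append_singleton l a ih =>
    rw [wordProd_append, wordProd_singleton, List.length_append, List.length_singleton]
    rcases lt_trichotomy (wordProd l ⟨a.val, by omega⟩) (wordProd l ⟨a.val + 1, by omega⟩)
      with h | h | h
    · rw [card_inversions_mul_simple _ a h]; omega
    · simp [Fin.ext_iff] at h
    · have := card_inversions_mul_simple_of_gt _ a h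
      omega

theorem eq_one_of_forall_lt {n : ℕ} (w : Perm (Fin n))
    (h : ∀ a : Fin (n - 1), w ⟨a.val, by omega⟩ < w ⟨a.val + 1, by omega⟩) : w = 1 := by
  obtain _ | n := n
  · exact Subsingleton.elim _ _
  have hm : StrictMono w := Fin.strictMono_iff_lt_succ.2 fun i => h i
  have := Subsingleton.elim (hm.orderIsoOfSurjective w w.surjective) (OrderIso.refl _)
  ext x
  exact congrArg Fin.val (DFunLike.congr_fun this x)

/-- A permutation other than the identity has a descent; undoing it removes exactly one inversion.
-/
theorem exists_word_length_eq {n : ℕ} (w : Perm (Fin n)) :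
    ∃ l, wordProd l = w ∧ l.length = (inversions w).card := by
  induction hk : (inversions w).card generalizing w with
  | zero =>
    refine ⟨[], ?_, rfl⟩
    rw [eq_one_of_forall_lt w]
    · rfl
    · intro a
      by_contra hc
      have hne : w ⟨a.val + 1, by omega⟩ ≠ w ⟨a.val, by omega⟩ := by simp [Fin.ext_iff]
      have := card_inversions_mul_simple_of_gt w a (lt_of_le_of_ne (not_lt.1 hc) hne)
      omega
  | succ k ih =>
    have hw : ∃ a : Fin (n - 1), w ⟨a.val + 1, by omega⟩ < w ⟨a.val, by omega⟩ := by
      by_contra! hc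
      have : w = 1 := by
        refine eq_one_of_forall_lt w fun a => lt_of_le_of_ne (hc a) ?_
        simp [Fin.ext_iff]
      have h0 := card_inversions_wordProd_le ([] : List (Fin (n - 1)))
      rw [show wordProd ([] : List (Fin (n - 1))) = w from this.symm] at h0
      rw [List.length_nil] at h0; omega
    obtain ⟨a, ha⟩ := hw
    have hc := card_inversions_mul_simple_of_gt w a ha
    obtain ⟨l, hl, hlen⟩ := ih (w * simple a) (by omega)
    refine ⟨l ++ [a], ?_, by simp [hlen]⟩
    rw [wordProd_append, wordProd_singleton, hl, mul_assoc, simple_mul_self, mul_one]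

theorem length_wordProd_le {n : ℕ} (l : List (Fin (n - 1))) : length (wordProd l) ≤ l.length :=
  Nat.sInf_le ⟨l, rfl, rfl⟩

theorem exists_word_length {n : ℕ} (w : Perm (Fin n)) :
    ∃ l, wordProd l = w ∧ l.length = length w := by
  obtain ⟨l, hl⟩ := exists_word w
  exact Nat.sInf_mem (s := {r | ∃ l, wordProd l = w ∧ l.length = r}) ⟨_, l, hl, rfl⟩

theorem length_eq_card_inversions {n : ℕ} (w : Perm (Fin n)) :
    length w = (inversions w).card := by
  apply le_antisymm
  · obtain ⟨l, rfl, h⟩ := exists_word_length_eq w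
    rw [← h]
    exact length_wordProd_le l
  · obtain ⟨l, rfl, h⟩ := exists_word_length w
    rw [← h]
    exact card_inversions_wordProd_le l

theorem inversions_subset_revPerm {n : ℕ} (w : Perm (Fin n)) :
    inversions w ⊆ inversions (Fin.revPerm : Perm (Fin n)) := by
  intro p hp
  rw [mem_inversions] at hp ⊢
  exact ⟨hp.1, by simpa using hp.1⟩

/-- The reversal inverts every pair, so a longest element does too; following it by the reversal
gives an increasing permutation, the identity. -/
theorem isLongest_iff {n : ℕ} (w : Perm (Fin n)) : IsLongest w ↔ w = Fin.revPerm := by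
  constructor
  · intro h
    have h1 := h Fin.revPerm
    rw [length_eq_card_inversions, length_eq_card_inversions] at h1
    have h2 := Finset.eq_of_subset_of_card_le (inversions_subset_revPerm w) h1
    have h3 : Fin.revPerm * w = 1 := by
      refine eq_one_of_forall_lt _ fun a => ?_
      have : ((⟨a.val, by omega⟩, ⟨a.val + 1, by omega⟩) : Fin n × Fin n) ∈ inversions w := by
        rw [h2, mem_inversions]
        simp [Fin.lt_def]
        omega
      simpa using (mem_inversions.1 this).2
    rw [← inv_eq_of_mul_eq_one_right h3]
    ext x
    rw [Perm.inv_def, Fin.revPerm_symm]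
  · rintro rfl v
    rw [length_eq_card_inversions, length_eq_card_inversions]
    exact Finset.card_le_card (inversions_subset_revPerm v)

/-! ### Coxeter elements as full cycles: order, centralizer, support -/

theorem commute_simple_simple {n : ℕ} (i j : Fin (n - 1)) (h1 : j.val ≠ i.val + 1)
    (h2 : i.val ≠ j.val + 1) : Commute (simple i) (simple j) := by
  ext x
  simp only [Perm.mul_apply, simple_val]
  split_ifs <;> omega

/-- A generator commutes with a word that does not contain a neighbour of it. -/
theorem commute_simple_wordProd {n : ℕ} (j : Fin (n - 1)) (l : List (Fin (n - 1)))
    (h : ∀ i ∈ l, j.val ≠ i.val + 1 ∧ i.val ≠ j.val + 1) :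
    Commute (simple j) (wordProd l) := by
  induction l with
  | nil => exact Commute.one_right _
  | cons a l ih =>
    rw [wordProd_cons]
    have := h a List.mem_cons_self
    exact (commute_simple_simple j a this.2 this.1).mul_right
      (ih fun i hi => h i (List.mem_cons_of_mem _ hi))

/-- After rotating the cycle to begin with `y`, left multiplication by the swap inserts `x` just
before `y`. -/
theorem swap_mul_formPerm {α : Type*} [DecidableEq α] (L : List α) (hL : L.Nodup) {x y : α}
    (hy : y ∈ L) (hx : x ∉ L) :
    ∃ L' : List α, L'.Nodup ∧ (∀ z, z ∈ L' ↔ z = x ∨ z ∈ L) ∧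
      swap x y * L.formPerm = L'.formPerm := by
  obtain ⟨s, t, rfl⟩ := List.append_of_mem hy
  have hr : s ++ y :: t ~r y :: t ++ s := List.isRotated_append
  refine ⟨x :: (y :: t ++ s), ?_, fun z => ?_, ?_⟩
  · rw [List.nodup_cons, ← hr.mem_iff, ← hr.nodup_iff]
    exact ⟨hx, hL⟩
  · rw [List.mem_cons, hr.mem_iff]
  · rw [List.formPerm_eq_of_isRotated hL hr]
    simp [List.formPerm_cons_cons]

/-- A product of the first `k` simple transpositions in any order is a cycle on the first
`k + 1` letters. -/
theorem exists_formPerm {n : ℕ} (k : ℕ) (hk : k < n) (l : List (Fin (n - 1))) (hl : l.Nodup)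
    (hmem : ∀ i, i ∈ l ↔ i.val < k) :
    ∃ L : List (Fin n), L.Nodup ∧ (∀ x, x ∈ L ↔ x.val ≤ k) ∧ wordProd l = L.formPerm := by
  induction k generalizing l with
  | zero =>
    obtain rfl : l = [] := List.eq_nil_iff_forall_not_mem.2 fun i hi => by simpa using (hmem i).1 hi
    refine ⟨[⟨0, hk⟩], List.nodup_singleton _, fun x => ?_, ?_⟩
    · simp [Fin.ext_iff]
    · simp [wordProd]
  | succ k ih =>
    set j : Fin (n - 1) := ⟨k, by omega⟩ with hj
    obtain ⟨a, b, rfl⟩ := List.append_of_mem ((hmem j).2 (Nat.lt_succ_self k))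
    rw [List.nodup_middle, List.nodup_cons] at hl
    have hmem' : ∀ i, i ∈ a ++ b ↔ i.val < k := by
      intro i
      have hi := hmem i
      rw [List.mem_append, List.mem_cons, or_left_comm, ← List.mem_append] at hi
      constructor
      · intro h
        have h1 := hi.1 (Or.inr h)
        have : i.val ≠ k := fun h2 => hl.1 ((Fin.ext h2 : i = j) ▸ h)
        omega
      · intro h
        refine (hi.2 (by omega)).resolve_left ?_
        rintro rfl
        simp [hj] at h
    obtain ⟨L, hL, hLmem, hprod⟩ := ih (by omega) (a ++ b) hl.2 hmem'
    have hx : (⟨k + 1, hk⟩ : Fin n) ∉ L := by rw [hLmem]; simp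
    have hsim : simple j = swap (⟨k + 1, hk⟩ : Fin n) ⟨k, by omega⟩ := swap_comm _ _
    have hfix : L.formPerm ⟨k + 1, hk⟩ = ⟨k + 1, hk⟩ := List.formPerm_apply_of_notMem hx
    -- The only neighbour of `j` among the remaining letters is `k - 1`, which occurs once, so `j`
    -- can be moved to the end of the word on the other side.
    have hcase : wordProd (a ++ j :: b) = wordProd (a ++ b) * simple j ∨
        wordProd (a ++ j :: b) = simple j * wordProd (a ++ b) := by
      rw [wordProd_append, wordProd_cons, wordProd_append]
      have hlt : ∀ i ∈ a ++ b, i.val < k := fun i hi => (hmem' i).1 hi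
      by_cases hb : ∃ i ∈ b, i.val + 1 = k
      · obtain ⟨i, hib, hik⟩ := hb
        right
        rw [(commute_simple_wordProd j a _).left_comm]
        intro i' hi'
        have h1 := hlt i' (List.mem_append_left _ hi')
        refine ⟨fun h => ?_, by simp only [hj]; omega⟩
        have : i' = i := Fin.ext (by simp only [hj] at h; omega)
        subst this
        exact List.disjoint_of_nodup_append hl.2 hi' hib
      · left
        rw [mul_assoc, (commute_simple_wordProd j b _).eq]
        intro i hi
        have h1 := hlt i (List.mem_append_right _ hi)
        exact ⟨fun h => hb ⟨i, hi, h.symm⟩, by simp only [hj]; omega⟩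
    have hex : ∃ y ∈ L, wordProd (a ++ j :: b) = swap ⟨k + 1, hk⟩ y * L.formPerm := by
      rcases hcase with h | h
      · refine ⟨L.formPerm ⟨k, by omega⟩, ?_, ?_⟩
        · rw [List.formPerm_mem_iff_mem, hLmem]
        · rw [h, hprod, hsim, mul_swap_eq_swap_mul, hfix]
      · refine ⟨⟨k, by omega⟩, ?_, ?_⟩
        · rw [hLmem]
        · rw [h, hprod, hsim]
    obtain ⟨y, hy, hw⟩ := hex
    obtain ⟨L', h1, h2, h3⟩ := swap_mul_formPerm L hL hy hx
    refine ⟨L', h1, fun x => ?_, hw.trans h3⟩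
    rw [h2, hLmem, Fin.ext_iff]
    simp only
    omega

theorem IsCoxeterElement.exists_formPerm {n : ℕ} (hn : 0 < n) {C : Perm (Fin n)}
    (hC : IsCoxeterElement C) : ∃ L : List (Fin n), L.Nodup ∧ (∀ x, x ∈ L) ∧ C = L.formPerm := by
  obtain ⟨l, h1, h2, rfl⟩ := hC
  obtain ⟨L, h3, h4, h5⟩ := CoxeterAdmissible.exists_formPerm (n - 1) (by omega) l h1
    fun i => ⟨fun _ => i.isLt, fun _ => h2 i⟩
  exact ⟨L, h3, fun x => (h4 x).2 (by omega), h5⟩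

theorem IsCoxeterElement.pow_eq_one {n : ℕ} (hn : 0 < n) {C : Perm (Fin n)}
    (hC : IsCoxeterElement C) : C ^ n = 1 := by
  obtain ⟨L, h1, h2, rfl⟩ := hC.exists_formPerm hn
  have h := List.formPerm_pow_length_eq_one_of_nodup L h1
  have hlen : L.length = n := by
    have hu : L.toFinset = Finset.univ := by ext x; simp [h2 x]
    rw [← List.toFinset_card_of_nodup h1, hu, Finset.card_univ, Fintype.card_fin]
  rwa [hlen] at h

/-- The centralizer of a Coxeter element consists of its powers. -/
theorem IsCoxeterElement.exists_zpow_of_commute {n : ℕ} (hn : 0 < n) {C σ : Perm (Fin n)}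
    (hC : IsCoxeterElement C) (h : Commute σ C) : ∃ j : ℤ, σ = C ^ j := by
  obtain ⟨L, h1, h2, rfl⟩ := hC.exists_formPerm hn
  have hcyc := List.Nodup.isCycleOn_formPerm h1
  obtain ⟨j, hj⟩ := hcyc.2 (h2 ⟨0, hn⟩) (h2 (σ ⟨0, hn⟩))
  refine ⟨j, Equiv.ext fun x => ?_⟩
  obtain ⟨i, rfl⟩ := hcyc.2 (h2 ⟨0, hn⟩) (h2 x)
  rw [← Perm.mul_apply, (h.zpow_right i).eq, Perm.mul_apply, ← hj, ← Perm.mul_apply,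
    ← Perm.mul_apply, ← zpow_add, ← zpow_add, add_comm]

/-- A word for a Coxeter element contains all simple transpositions. -/
theorem IsCoxeterElement.mem_of_wordProd {n : ℕ} {C : Perm (Fin n)} (hC : IsCoxeterElement C)
    {l : List (Fin (n - 1))} (hl : wordProd l = C) (j : Fin (n - 1)) : j ∈ l := by
  by_contra hj
  obtain ⟨l', h1, h2, h3⟩ := hC
  obtain ⟨a, b, rfl⟩ := List.append_of_mem (h2 j)
  rw [List.nodup_middle, List.nodup_cons, List.mem_append, not_or] at h1
  -- A word without `j` preserves the set of letters at most `j`. If `l` omitted `j`, then comparing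
  -- it with `a ++ j :: b` would force `simple j` to preserve this set as well.
  have key : ∀ x : Fin n, x.val ≤ j.val ↔ (simple j x).val ≤ j.val := by
    intro x
    have e1 := inv_wordProd_side j l hj (wordProd a x)
    have e2 := inv_wordProd_side j a h1.1.1 (wordProd a x)
    have e3 := inv_wordProd_side j b h1.1.2 (simple j x)
    have e4 : (wordProd (a ++ j :: b))⁻¹ (wordProd a x) = (wordProd b)⁻¹ (simple j x) := by
      rw [wordProd_append, wordProd_cons]
      simp [mul_inv_rev, simple]
    rw [hl, ← h3, e4] at e1
    rw [Perm.inv_def, symm_apply_apply] at e2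
    rw [e2, ← e1, e3]
  have := key ⟨j.val, by omega⟩
  rw [simple_val] at this
  simp at this

/-! ### Half words and the factorization of a Coxeter element -/

/-- The word obtained by reflecting all simple transpositions, that is, by conjugating with the
longest element. -/
def mirror {n : ℕ} (l : List (Fin (n - 1))) : List (Fin (n - 1)) := l.map Fin.rev

theorem mem_mirror {n : ℕ} {l : List (Fin (n - 1))} {i : Fin (n - 1)} :
    i ∈ mirror l ↔ i.rev ∈ l := by
  rw [mirror, List.mem_map]
  exact ⟨fun ⟨a, h1, h2⟩ => by rwa [← h2, Fin.rev_rev], fun h => ⟨_, h, Fin.rev_rev i⟩⟩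

theorem simple_rev {n : ℕ} (i : Fin (n - 1)) :
    simple i.rev = Fin.revPerm * simple i * Fin.revPerm := by
  ext x
  simp only [Perm.mul_apply, Fin.revPerm_apply, simple_val, Fin.val_rev]
  split_ifs <;> omega

theorem revPerm_mul_self {n : ℕ} : (Fin.revPerm : Perm (Fin n)) * Fin.revPerm = 1 := by
  ext x
  simp

theorem wordProd_mirror {n : ℕ} (l : List (Fin (n - 1))) :
    wordProd (mirror l) = Fin.revPerm * wordProd l * Fin.revPerm := by
  induction l with
  | nil => simp [mirror, wordProd, revPerm_mul_self]
  | cons a l ih =>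
    rw [mirror, List.map_cons, wordProd_cons, wordProd_cons, simple_rev, ← mirror, ih]
    simp only [mul_assoc]
    rw [← mul_assoc Fin.revPerm Fin.revPerm, revPerm_mul_self, one_mul]

/-- Words whose mirror image followed by themselves is a word of a Coxeter element. -/
def IsHalfWord {n : ℕ} (l : List (Fin (n - 1))) : Prop :=
  (mirror l ++ l).Nodup ∧ ∀ i, i ∈ mirror l ++ l

/-- The Coxeter element of a half word. -/
def double {n : ℕ} (l : List (Fin (n - 1))) : Perm (Fin n) := wordProd (mirror l ++ l)

theorem IsHalfWord.isCoxeterWord {n : ℕ} {l : List (Fin (n - 1))} (h : IsHalfWord l) :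
    IsCoxeterWord (mirror l ++ l) (double l) := ⟨h.1, h.2, rfl⟩

theorem double_eq {n : ℕ} (l : List (Fin (n - 1))) :
    double l = wordProd (mirror l) * wordProd l := wordProd_append _ _

/-- A half word chooses one generator from each mirror pair; its order is free. -/
theorem isHalfWord_iff {n : ℕ} {l : List (Fin (n - 1))} :
    IsHalfWord l ↔ l.Nodup ∧ ∀ i : Fin (n - 1), i ∈ l ↔ i.rev ∉ l := by
  have hdis : List.Disjoint (mirror l) l ↔ ∀ i ∈ l, i.rev ∉ l := by
    simp only [List.Disjoint, mem_mirror]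
    exact ⟨fun h i hi hr => h hr hi, fun h i hr hi => h i hi hr⟩
  simp only [IsHalfWord, List.nodup_append', hdis, List.mem_append, mem_mirror]
  constructor
  · rintro ⟨⟨-, h1, h2⟩, h3⟩
    exact ⟨h1, fun i => ⟨h2 i, fun h => (h3 i).resolve_left h⟩⟩
  · rintro ⟨h1, h2⟩
    exact ⟨⟨h1.map Fin.rev_injective, h1, fun i => (h2 i).1⟩, fun i => by
      have := h2 i; tauto⟩

theorem IsHalfWord.mem_iff {n : ℕ} {l : List (Fin (n - 1))} (h : IsHalfWord l) (i : Fin (n - 1)) :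
    i ∈ l ↔ i.rev ∉ l := (isHalfWord_iff.1 h).2 i

theorem IsCoxeterElement.length_le_of_wordProd {n : ℕ} {C : Perm (Fin n)}
    (hC : IsCoxeterElement C) {l : List (Fin (n - 1))} (hl : wordProd l = C) :
    n - 1 ≤ l.length := by
  have h : Finset.univ ⊆ l.toFinset := fun i _ => by simpa using hC.mem_of_wordProd hl i
  simpa using (Finset.card_le_card h).trans (List.toFinset_card_le l)

theorem IsHalfWord.two_mul_length {n : ℕ} {l : List (Fin (n - 1))} (h : IsHalfWord l) :
    2 * l.length = n - 1 := by
  have hu : (mirror l ++ l).toFinset = Finset.univ := by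
    ext i; simpa using h.2 i
  have := List.toFinset_card_of_nodup h.1
  rw [hu, Finset.card_univ, Fintype.card_fin, List.length_append, mirror, List.length_map] at this
  omega

/-- A shorter word for either half would give the Coxeter element a word with fewer than `n - 1`
letters, which would miss a generator. -/
theorem IsHalfWord.length_wordProd {n : ℕ} {l : List (Fin (n - 1))} (h : IsHalfWord l) :
    length (wordProd l) = l.length ∧ length (wordProd (mirror l)) = l.length := by
  have hC : IsCoxeterElement (double l) := ⟨_, h.isCoxeterWord⟩
  have h1 := length_wordProd_le l
  have h2 := length_wordProd_le (mirror l)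
  have h3 : (mirror l).length = l.length := List.length_map _
  obtain ⟨a, ha, hal⟩ := exists_word_length (wordProd l)
  obtain ⟨b, hb, hbl⟩ := exists_word_length (wordProd (mirror l))
  have h4 := hC.length_le_of_wordProd (l := b ++ a) (by rw [wordProd_append, ha, hb, double_eq])
  rw [List.length_append] at h4
  have := h.two_mul_length
  omega

/-- The factorization property of Coxeter elements in terms of half words. -/
theorem exists_factorization_iff {m : ℕ} (hm : 1 ≤ m) {C : Perm (Fin (2 * m - 1))}
    (hC : IsCoxeterElement C) :
    (∃ w₁ w₂ : Perm (Fin (2 * m - 1)), length w₁ = m - 1 ∧ length w₂ = m - 1 ∧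
      C = w₁ * w₂ ∧ IsLongest (w₂ * C ^ (m - 1))) ↔
    ∃ l : List (Fin (2 * m - 1 - 1)), IsHalfWord l ∧ C = double l := by
  have hpos : 0 < 2 * m - 1 := by omega
  have hpow : C ^ m * C ^ (m - 1) = 1 := by
    rw [← pow_add, ← hC.pow_eq_one hpos]; congr 1; omega
  constructor
  · rintro ⟨w₁, w₂, -, h2, h3, h4⟩
    rw [isLongest_iff] at h4
    have e2 : w₂ = Fin.revPerm * C ^ m := by
      rw [← h4, mul_assoc, ← pow_add, add_comm, pow_add, hpow, mul_one]
    -- From `C^(2m) = C` and `C^m = w₀ w₂` one gets `w₁ w₂ = w₀ w₂ w₀ w₂`; cancel `w₂`.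
    have e1 : w₁ = Fin.revPerm * w₂ * Fin.revPerm := by
      have : w₁ * w₂ = C ^ m * C ^ m := by
        rw [← h3, ← pow_add, show m + m = (2 * m - 1) + 1 by omega, pow_succ,
          hC.pow_eq_one hpos, one_mul]
      have e3 : C ^ m = Fin.revPerm * w₂ := by
        rw [e2, ← mul_assoc, revPerm_mul_self, one_mul]
      rw [e3, ← mul_assoc] at this
      exact mul_right_cancel this
    obtain ⟨l, hl, hlen⟩ := exists_word_length w₂
    have hd : wordProd (mirror l ++ l) = C := by
      rw [wordProd_append, wordProd_mirror, hl, ← e1, h3]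
    have hall := hC.mem_of_wordProd hd
    refine ⟨l, ⟨?_, hall⟩, hd.symm⟩
    -- All `2m - 2` generators occur in a word of `2(m - 1)` letters, so none is repeated.
    have hu : (mirror l ++ l).toFinset = Finset.univ := by
      ext i; simpa using hall i
    rw [← Multiset.coe_nodup, ← Multiset.toFinset_card_eq_card_iff_nodup]
    change (mirror l ++ l).toFinset.card = (mirror l ++ l).length
    rw [hu, Finset.card_univ, Fintype.card_fin, List.length_append, mirror, List.length_map, hlen,
      h2]
    omega
  · rintro ⟨l, hl, hCl⟩
    have hlen := hl.two_mul_length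
    obtain ⟨h1, h2⟩ := hl.length_wordProd
    refine ⟨wordProd (mirror l), wordProd l, by omega, by omega, hCl.trans (double_eq l), ?_⟩
    rw [isLongest_iff]
    -- Here `σ² = C`, so `σ` commutes with `C` and is a power of it; therefore `σ^(2m-1) = 1`, which
    -- is `σ C^(m-1) = 1`.
    set σ : Perm (Fin (2 * m - 1)) := Fin.revPerm * wordProd l with hσ
    have hsq : C = σ * σ := by
      rw [hCl, double_eq, wordProd_mirror, hσ]; simp only [mul_assoc]
    obtain ⟨j, hj⟩ := hC.exists_zpow_of_commute hpos (σ := σ)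
      (by rw [hsq]; exact (Commute.refl σ).mul_right (Commute.refl σ))
    have hord : σ ^ (2 * m - 1) = 1 := by
      rw [hj, ← zpow_natCast, ← zpow_mul, zpow_mul', zpow_natCast, hC.pow_eq_one hpos,
        one_zpow]
    have hone : σ * C ^ (m - 1) = 1 := by
      rw [hsq, ← pow_two, ← pow_mul, ← pow_succ', ← hord]
      congr 1
      omega
    have : wordProd l = Fin.revPerm * σ := by
      rw [hσ, ← mul_assoc, revPerm_mul_self, one_mul]
    rw [this, mul_assoc, hone, mul_one]

/-! ### The height of the double of a half word -/

theorem idxOf_map_of_injective {α β : Type*} [DecidableEq α] [DecidableEq β] {f : α → β}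
    (hf : Function.Injective f) (l : List α) (x : α) : (l.map f).idxOf (f x) = l.idxOf x := by
  induction l with
  | nil => simp
  | cons a l ih =>
    rw [List.map_cons]
    by_cases h : a = x
    · subst h; rw [List.idxOf_cons_self, List.idxOf_cons_self]
    · rw [List.idxOf_cons_ne _ (hf.ne h), List.idxOf_cons_ne _ h, ih]

/-- If the two neighbouring generators lie in the same half, their mirror images occur in the same
relative order, and as left and right are exchanged the two entries cancel. If they lie in different
halves, the two entries agree. The right side is a difference of indicator values, made to
telescope. -/
theorem pathOfWord_add_pathOfWord_rev {n : ℕ} {l : List (Fin (n - 1))} (hl : IsHalfWord l)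
    (k : Fin (n - 2)) :
    pathOfWord (mirror l ++ l) k + pathOfWord (mirror l ++ l) k.rev =
      2 * ((if (⟨k.val, by omega⟩ : Fin (n - 1)) ∈ l then 1 else 0) -
        (if (⟨k.val + 1, by omega⟩ : Fin (n - 1)) ∈ l then 1 else 0)) := by
  have hin : ∀ x ∈ l, (mirror l ++ l).idxOf x = l.length + l.idxOf x := by
    intro x hx
    rw [List.idxOf_append_of_notMem, mirror, List.length_map]
    rw [mem_mirror]
    exact (hl.mem_iff x).1 hx
  have hout : ∀ x ∉ l, (mirror l ++ l).idxOf x = l.idxOf x.rev := by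
    intro x hx
    have hm : x.rev ∈ l := by rwa [hl.mem_iff, Fin.rev_rev]
    rw [List.idxOf_append_of_mem (mem_mirror.2 hm)]
    conv_lhs => rw [← Fin.rev_rev x]
    exact idxOf_map_of_injective Fin.rev_injective l _
  have hlt : ∀ x ∈ l, l.idxOf x < l.length := fun x hx => List.idxOf_lt_length_of_mem hx
  have key : ∀ a b : Fin (n - 1), a ≠ b →
      (if (mirror l ++ l).idxOf b < (mirror l ++ l).idxOf a then (1 : ℤ) else -1) +
        (if (mirror l ++ l).idxOf a.rev < (mirror l ++ l).idxOf b.rev then (1 : ℤ) else -1) =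
      2 * ((if a ∈ l then 1 else 0) - (if b ∈ l then 1 else 0)) := by
    intro a b hab
    by_cases ha : a ∈ l <;> by_cases hb : b ∈ l
    · have ha' := (hl.mem_iff a).1 ha
      have hb' := (hl.mem_iff b).1 hb
      rw [hin a ha, hin b hb, hout _ ha', hout _ hb', Fin.rev_rev, Fin.rev_rev]
      have : l.idxOf a ≠ l.idxOf b := fun h => hab ((List.idxOf_inj ha).1 h)
      simp only [ha, hb, if_true]
      split_ifs <;> omega
    · have ha' := (hl.mem_iff a).1 ha
      have hb' : b.rev ∈ l := by rwa [hl.mem_iff, Fin.rev_rev]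
      rw [hin a ha, hout b hb, hout _ ha', hin _ hb', Fin.rev_rev]
      have := hlt _ ha
      have := hlt _ hb'
      simp only [ha, hb, if_true, if_false]
      split_ifs <;> omega
    · have hb' := (hl.mem_iff b).1 hb
      have ha' : a.rev ∈ l := by rwa [hl.mem_iff, Fin.rev_rev]
      rw [hin b hb, hout a ha, hout _ hb', hin _ ha', Fin.rev_rev]
      have := hlt _ hb
      have := hlt _ ha'
      simp only [ha, hb, if_true, if_false]
      split_ifs <;> omega
    · have ha' : a.rev ∈ l := by rwa [hl.mem_iff, Fin.rev_rev]
      have hb' : b.rev ∈ l := by rwa [hl.mem_iff, Fin.rev_rev]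
      rw [hout a ha, hout b hb, hin _ ha', hin _ hb']
      have : l.idxOf a.rev ≠ l.idxOf b.rev := fun h =>
        hab (Fin.rev_injective ((List.idxOf_inj ha').1 h))
      simp only [ha, hb, if_false]
      split_ifs <;> omega
  have h := key ⟨k.val, by omega⟩ ⟨k.val + 1, by omega⟩ (by simp [Fin.ext_iff])
  have e1 : (⟨k.val, by omega⟩ : Fin (n - 1)).rev = ⟨k.rev.val + 1, by omega⟩ := by
    ext; simp only [Fin.val_rev]; omega
  have e2 : (⟨k.val + 1, by omega⟩ : Fin (n - 1)).rev = ⟨k.rev.val, by omega⟩ := by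
    ext; simp only [Fin.val_rev]; omega
  rw [e1, e2] at h
  exact h

/-- Summing the path with its reversal counts the height twice and telescopes to the two outermost
generators, exactly one of which lies in `l`. -/
theorem IsHalfWord.height_double {n : ℕ} (hn : 2 ≤ n) {l : List (Fin (n - 1))}
    (hl : IsHalfWord l) :
    height (double l) = if (⟨0, by omega⟩ : Fin (n - 1)) ∈ l then 1 else -1 := by
  set g : ℕ → ℤ := fun i => if h : i < n - 1 then (if (⟨i, h⟩ : Fin (n - 1)) ∈ l then 1 else 0)
    else 0 with hg
  have hgv : ∀ i (h : i < n - 1), g i = if (⟨i, h⟩ : Fin (n - 1)) ∈ l then 1 else 0 :=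
    fun i h => dif_pos h
  have h1 : height (double l) = ∑ k, pathOfWord (mirror l ++ l) k := by
    rw [height, path_eq hl.isCoxeterWord]
  have h2 : ∑ k, pathOfWord (mirror l ++ l) k = ∑ k : Fin (n - 2),
      pathOfWord (mirror l ++ l) k.rev :=
    (Equiv.sum_comp Fin.revPerm (pathOfWord (mirror l ++ l))).symm
  have h3 : ∑ k : Fin (n - 2), (pathOfWord (mirror l ++ l) k + pathOfWord (mirror l ++ l) k.rev) =
      2 * (g 0 - g (n - 2)) := by
    rw [← Finset.sum_range_sub', Finset.mul_sum, ← Fin.sum_univ_eq_sum_range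
      (fun i => 2 * (g i - g (i + 1)))]
    refine Finset.sum_congr rfl fun k _ => ?_
    rw [pathOfWord_add_pathOfWord_rev hl, hgv _ (by omega), hgv _ (by omega)]
  rw [Finset.sum_add_distrib, ← h2, ← h1, hgv _ (by omega), hgv _ (by omega)] at h3
  have h4 : (⟨n - 2, by omega⟩ : Fin (n - 1)) = (⟨0, by omega⟩ : Fin (n - 1)).rev := by
    ext; simp only [Fin.val_rev]; omega
  rw [h4] at h3
  have h5 := hl.mem_iff ⟨0, by omega⟩
  split_ifs at h3 ⊢ <;> first | omega | tauto

/-! ### Words and heights of extensions -/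

/-- The inclusion of the simple transpositions of `𝔖_n` into those of `𝔖_{n+2}`. -/
def shift {n : ℕ} (i : Fin (n - 1)) : Fin (n + 2 - 1) := ⟨i.val + 1, by omega⟩

theorem shift_injective {n : ℕ} : Function.Injective (shift (n := n)) := fun i j h => by
  simpa [shift, Fin.ext_iff] using h

theorem shift_rev {n : ℕ} (i : Fin (n - 1)) : shift i.rev = (shift i).rev := by
  ext; simp only [shift, Fin.val_rev]; omega

theorem mirror_map_shift {n : ℕ} (l : List (Fin (n - 1))) :
    mirror (l.map shift) = (mirror l).map shift := by
  simp only [mirror, List.map_map]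
  exact List.map_congr_left fun i _ => (shift_rev i).symm

theorem mirror_append {n : ℕ} (l l' : List (Fin (n - 1))) :
    mirror (l ++ l') = mirror l ++ mirror l' := List.map_append

theorem mirror_cons {n : ℕ} (i : Fin (n - 1)) (l : List (Fin (n - 1))) :
    mirror (i :: l) = i.rev :: mirror l := rfl

theorem mirror_singleton {n : ℕ} (i : Fin (n - 1)) : mirror [i] = [i.rev] := rfl

theorem bar_mul {n : ℕ} (v w : Perm (Fin n)) : bar (v * w) = bar v * bar w :=
  map_mul (Perm.viaEmbeddingHom _) v w

theorem bar_one {n : ℕ} : bar (1 : Perm (Fin n)) = 1 := map_one (Perm.viaEmbeddingHom _)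

theorem simple_shift_val {n : ℕ} (i : Fin (n - 1)) (x : Fin (n + 2)) :
    (simple (shift i) x).val = if x.val = i.val + 1 then i.val + 2 else
      if x.val = i.val + 2 then i.val + 1 else x.val := simple_val _ _

theorem bar_simple {n : ℕ} (i : Fin (n - 1)) : bar (simple i) = simple (shift i) := by
  ext x
  by_cases hx : x ∈ Set.range (Fin.castSuccEmb.trans (Fin.succEmb (n + 1)))
  · obtain ⟨y, rfl⟩ := hx
    rw [bar, Perm.viaEmbedding_apply]
    have : ∀ z : Fin n, ((Fin.castSuccEmb.trans (Fin.succEmb (n + 1))) z).val = z.val + 1 :=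
      fun z => rfl
    rw [simple_shift_val, this, this, simple_val]
    split_ifs <;> omega
  · rw [bar, Perm.viaEmbedding_apply_of_notMem _ _ _ hx, simple_shift_val]
    have h1 : ¬ (1 ≤ x.val ∧ x.val ≤ n) := fun h =>
      hx ⟨⟨x.val - 1, by omega⟩, Fin.ext (Nat.sub_add_cancel h.1)⟩
    split_ifs <;> omega

theorem bar_wordProd {n : ℕ} (l : List (Fin (n - 1))) :
    bar (wordProd l) = wordProd (l.map shift) := by
  induction l with
  | nil => exact bar_one
  | cons a l ih => rw [wordProd_cons, bar_mul, bar_simple, ih, List.map_cons, wordProd_cons]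

/-- The first simple transposition of `𝔖_{n+2}`. -/
def first (n : ℕ) : Fin (n + 2 - 1) := ⟨0, by omega⟩

/-- The last simple transposition of `𝔖_{n+2}`. -/
def last (n : ℕ) : Fin (n + 2 - 1) := ⟨n, by omega⟩

theorem rev_first (n : ℕ) : (first n).rev = last n := by
  ext; simp only [first, last, Fin.val_rev]; omega

theorem rev_last (n : ℕ) : (last n).rev = first n := by
  rw [← rev_first, Fin.rev_rev]

theorem first_ne_shift {n : ℕ} (i : Fin (n - 1)) : first n ≠ shift i := by
  simp [first, shift, Fin.ext_iff]

theorem last_ne_shift {n : ℕ} (i : Fin (n - 1)) : last n ≠ shift i := by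
  simp only [last, shift, ne_eq, Fin.ext_iff]; omega

theorem first_ne_last {n : ℕ} (hn : 2 ≤ n) : first n ≠ last n := by
  simp only [first, last, ne_eq, Fin.ext_iff]; omega

theorem eq_first_or_last_or_shift {n : ℕ} (i : Fin (n + 2 - 1)) :
    i = first n ∨ i = last n ∨ ∃ j, i = shift j := by
  by_cases h0 : i.val = 0
  · exact Or.inl (Fin.ext h0)
  by_cases h1 : i.val = n
  · exact Or.inr (Or.inl (Fin.ext h1))
  · exact Or.inr (Or.inr ⟨⟨i.val - 1, by omega⟩, by ext; simp only [shift]; omega⟩)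

/-- The change of height under the two unbalanced extensions. -/
theorem IsCoxeterWord.height_extension {n : ℕ} (hn : 2 ≤ n) {c : List (Fin (n - 1))}
    {C : Perm (Fin n)} (hc : IsCoxeterWord c C) :
    height (rightGen n * bar C * leftGen n) = height C + 2 ∧
      height (leftGen n * bar C * rightGen n) = height C - 2 := by
  obtain ⟨q, rfl⟩ : ∃ q, n = q + 2 := ⟨n - 2, by omega⟩
  have hword : ∀ x y : Fin (q + 2 + 2 - 1), x ≠ y → (∀ j, x ≠ shift j) → (∀ j, y ≠ shift j) →
      (∀ i, i = x ∨ i = y ∨ ∃ j, i = shift j) →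
      IsCoxeterWord (x :: (c.map shift ++ [y])) (simple x * bar C * simple y) := by
    intro x y hxy hx hy hall
    refine ⟨?_, fun i => ?_, ?_⟩
    · rw [List.nodup_cons, List.nodup_append']
      refine ⟨?_, hc.1.map shift_injective, List.nodup_singleton _, ?_⟩
      · simp only [List.mem_append, List.mem_map, List.mem_singleton, not_or, not_exists, not_and]
        exact ⟨fun j _ h => hx j h.symm, hxy⟩
      · rw [List.disjoint_singleton, List.mem_map]
        rintro ⟨j, -, h⟩
        exact hy j h.symm
    · rcases hall i with rfl | rfl | ⟨j, rfl⟩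
      · simp
      · simp
      · have := List.mem_map_of_mem (f := shift) (hc.2.1 j)
        simp only [List.mem_cons, List.mem_append]
        tauto
    · rw [wordProd_cons, wordProd_append, wordProd_singleton, ← bar_wordProd, hc.2.2, mul_assoc]
  have hmid : ∀ (x y : Fin (q + 2 + 2 - 1)), (∀ j : Fin (q + 2 - 1), x ≠ shift j) → ∀ b ∈ c,
      (x :: (c.map shift ++ [y])).idxOf (shift b) = c.idxOf b + 1 := by
    intro x y hx b hb
    rw [List.idxOf_cons_ne _ (hx b), List.idxOf_append_of_mem (List.mem_map_of_mem hb),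
      idxOf_map_of_injective shift_injective]
  have hlast : ∀ (x y : Fin (q + 2 + 2 - 1)), x ≠ y → (∀ j : Fin (q + 2 - 1), y ≠ shift j) →
      (x :: (c.map shift ++ [y])).idxOf y = c.length + 1 := by
    intro x y hxy hy
    rw [List.idxOf_cons_ne _ hxy, List.idxOf_append_of_notMem, List.length_map,
      List.idxOf_cons_self]
    rw [List.mem_map]
    rintro ⟨j, -, h⟩
    exact hy j h.symm
  -- The inner path entries are those of `C`; only the comparisons of each outer generator with its
  -- neighbour are new.
  have hsum : ∀ (x y : Fin (q + 2 + 2 - 1)), (∀ j : Fin (q + 2 - 1), x ≠ shift j) →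
      IsCoxeterWord (x :: (c.map shift ++ [y])) (simple x * bar C * simple y) →
      height (simple x * bar C * simple y) = height C +
        ((if (x :: (c.map shift ++ [y])).idxOf (shift (0 : Fin (q + 1))) <
          (x :: (c.map shift ++ [y])).idxOf (first (q + 2)) then 1 else -1) +
        (if (x :: (c.map shift ++ [y])).idxOf (last (q + 2)) <
          (x :: (c.map shift ++ [y])).idxOf (shift (Fin.last q : Fin (q + 1)))
          then 1 else -1)) := by
    intro x y hx hw
    rw [height, height, path_eq hc, path_eq hw]
    have := Fin.sum_univ_castSucc (n := q + 1) (pathOfWord (n := q + 2 + 2)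
      (x :: (c.map shift ++ [y])))
    refine this.trans ?_
    rw [Fin.sum_univ_succ]
    have hin : ∀ i : Fin q, pathOfWord (n := q + 2 + 2) (x :: (c.map shift ++ [y]))
        (i.succ.castSucc : Fin (q + 1 + 1)) = pathOfWord (n := q + 2) c i := by
      intro i
      have e1 := hmid x y hx ⟨i.val + 1, by omega⟩ (hc.2.1 _)
      have e0 := hmid x y hx ⟨i.val, by omega⟩ (hc.2.1 _)
      rw [pathOfWord, pathOfWord]
      congr 1
      rw [eq_iff_iff, ← Nat.add_lt_add_iff_right (m := c.idxOf _) (k := 1), ← e1, ← e0]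
      rfl
    rw [Finset.sum_congr rfl fun i _ => hin i, add_right_comm, add_comm]
    rfl
  have hlt : ∀ b, c.idxOf b < c.length := fun b => List.idxOf_lt_length_of_mem (hc.2.1 b)
  have hfl := first_ne_last hn
  constructor
  · have hw := hword (last _) (first _) hfl.symm last_ne_shift first_ne_shift fun i => by
      have := eq_first_or_last_or_shift i; tauto
    refine (hsum _ _ last_ne_shift hw).trans ?_
    rw [hmid _ _ last_ne_shift _ (hc.2.1 _), hmid _ _ last_ne_shift _ (hc.2.1 _),
      hlast _ _ hfl.symm first_ne_shift, List.idxOf_cons_self, if_pos, if_pos]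
    · rfl
    · omega
    · have := hlt (0 : Fin (q + 1)); omega
  · have hw := hword (first _) (last _) hfl first_ne_shift last_ne_shift eq_first_or_last_or_shift
    refine (hsum _ _ first_ne_shift hw).trans ?_
    rw [hmid _ _ first_ne_shift _ (hc.2.1 _), hmid _ _ first_ne_shift _ (hc.2.1 _),
      hlast _ _ hfl last_ne_shift, List.idxOf_cons_self, if_neg, if_neg]
    · rfl
    · have := hlt (Fin.last q : Fin (q + 1)); omega
    · omega

/-! ### Inserting an outer generator into a half word -/

theorem isHalfWord_perm {n : ℕ} {l l' : List (Fin (n - 1))} (h : l.Perm l') :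
    IsHalfWord l ↔ IsHalfWord l' := by
  simp only [isHalfWord_iff, h.nodup_iff, h.mem_iff]

/-- The outer generators form one new mirror pair, and `x` is the choice from it. -/
theorem isHalfWord_cons_map_shift {n : ℕ} (hn : 2 ≤ n) {l : List (Fin (n - 1))}
    {x : Fin (n + 2 - 1)} (hx : x = first n ∨ x = last n) :
    IsHalfWord (x :: l.map shift) ↔ IsHalfWord l := by
  have hxs : ∀ j : Fin (n - 1), shift j ≠ x := fun j => by
    rcases hx with rfl | rfl
    · exact (first_ne_shift j).symm
    · exact (last_ne_shift j).symm
  have hmem : ∀ j : Fin (n - 1), shift j ∈ x :: l.map shift ↔ j ∈ l := fun j => by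
    rw [List.mem_cons, List.mem_map_of_injective shift_injective, or_iff_right (hxs j)]
  have hout : ∀ y : Fin (n + 2 - 1), (∀ j : Fin (n - 1), y ≠ shift j) →
      (y ∈ x :: l.map shift ↔ y = x) := fun y hy => by
    rw [List.mem_cons, List.mem_map, or_iff_left]
    rintro ⟨j, -, h⟩
    exact hy j h.symm
  have hfl := first_ne_last hn
  rw [isHalfWord_iff, isHalfWord_iff, List.nodup_cons, List.nodup_map_iff shift_injective]
  have hxl : x ∉ l.map shift := by
    rw [List.mem_map]
    rintro ⟨j, -, h⟩
    exact hxs j h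
  constructor
  · rintro ⟨⟨-, h1⟩, h2⟩
    refine ⟨h1, fun j => ?_⟩
    rw [← hmem, h2, ← shift_rev, hmem]
  · rintro ⟨h1, h2⟩
    refine ⟨⟨hxl, h1⟩, fun i => ?_⟩
    rcases eq_first_or_last_or_shift i with rfl | rfl | ⟨j, rfl⟩
    · rw [rev_first, hout _ first_ne_shift, hout _ last_ne_shift]
      rcases hx with rfl | rfl
      · simp [hfl.symm]
      · simp [hfl]
    · rw [rev_last, hout _ first_ne_shift, hout _ last_ne_shift]
      rcases hx with rfl | rfl
      · simp [hfl.symm]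
      · simp [hfl]
    · rw [← shift_rev, hmem, hmem, h2]

theorem commute_first {n : ℕ} {l : List (Fin (n - 1))} (h : ∀ i ∈ l, i.val ≠ 0) :
    Commute (simple (first n)) (wordProd (l.map shift)) := by
  refine commute_simple_wordProd _ _ fun i hi => ?_
  obtain ⟨j, hj, rfl⟩ := List.mem_map.1 hi
  have := h j hj
  simp only [first, shift]
  omega

theorem commute_last {n : ℕ} {l : List (Fin (n - 1))} (h : ∀ i ∈ l, i.val ≠ n - 2) :
    Commute (simple (last n)) (wordProd (l.map shift)) := by
  refine commute_simple_wordProd _ _ fun i hi => ?_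
  obtain ⟨j, hj, rfl⟩ := List.mem_map.1 hi
  have := h j hj
  simp only [last, shift]
  omega

theorem commute_first_last {n : ℕ} (hn : 2 ≤ n) :
    Commute (simple (first n)) (simple (last n)) :=
  commute_simple_simple _ _ (by simp only [first, last]; omega) (by simp only [first, last]; omega)

theorem bar_double {n : ℕ} (l : List (Fin (n - 1))) :
    bar (double l) = wordProd ((mirror l).map shift) * wordProd (l.map shift) := by
  rw [double_eq, bar_mul, bar_wordProd, bar_wordProd]

/-- Inserting an outer generator into a half word produces an extension. -/
theorem isExtension_double {n : ℕ} (hn : 2 ≤ n) {a b : List (Fin (n - 1))}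
    (hl : IsHalfWord (a ++ b)) {x : Fin (n + 2 - 1)} (hx : x = first n ∨ x = last n) :
    IsExtension (double (a ++ b)) (double (a.map shift ++ x :: b.map shift)) := by
  have hdis := List.disjoint_of_nodup_append (isHalfWord_iff.1 hl).1
  have hcomm := commute_first_last hn
  rw [IsExtension, bar_double]
  simp only [double_eq, mirror_append, mirror_cons, List.map_append, mirror_map_shift,
    wordProd_append, wordProd_cons]
  change _ = simple (first n) * simple (last n) * _ ∨ _ = _ * simple (first n) * simple (last n) ∨
    _ = simple (first n) * _ * simple (last n) ∨ _ = simple (last n) * _ * simple (first n)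
  -- `z` shifts to the only neighbour of `first n`, and `z.rev` to that of `last n`. An outer
  -- generator thus passes any block lacking the corresponding letter, and the location of `z` or
  -- `z.rev` decides which extension results.
  set z : Fin (n - 1) := ⟨0, by omega⟩
  have hz : z.rev.val = n - 2 := by simp only [z, Fin.val_rev]; omega
  have c1 : ∀ c : List (Fin (n - 1)), z ∉ c →
      Commute (simple (first n)) (wordProd (c.map shift)) ∧
      Commute (simple (last n)) (wordProd ((mirror c).map shift)) := fun c hc => by
    refine ⟨commute_first fun i hi h => hc ?_, commute_last fun i hi h => hc ?_⟩
    · rwa [show z = i from Fin.ext h.symm]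
    · rw [mem_mirror, show i = z.rev from Fin.ext (h.trans hz.symm), Fin.rev_rev] at hi
      exact hi
  have c2 : ∀ c : List (Fin (n - 1)), z.rev ∉ c →
      Commute (simple (last n)) (wordProd (c.map shift)) ∧
      Commute (simple (first n)) (wordProd ((mirror c).map shift)) := fun c hc => by
    refine ⟨commute_last fun i hi h => hc ?_, commute_first fun i hi h => hc ?_⟩
    · rwa [show z.rev = i from Fin.ext (hz.trans h.symm)]
    · rwa [mem_mirror, show i = z from Fin.ext h] at hi
  have hzm := hl.mem_iff z
  simp only [List.mem_append, not_or] at hzm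
  have hdz : ¬ (z ∈ a ∧ z ∈ b) := fun h => hdis h.1 h.2
  have hdz' : ¬ (z.rev ∈ a ∧ z.rev ∈ b) := fun h => hdis h.1 h.2
  rcases hx with rfl | rfl
  · rw [rev_first]
    set s := simple (first n)
    set t := simple (last n)
    by_cases ha : z ∈ a
    · obtain ⟨h1, h2⟩ := c1 b (by tauto)
      obtain ⟨h3, h4⟩ := c2 a (by tauto)
      obtain ⟨h5, h6⟩ := c2 b (by tauto)
      right; left
      simp only [mul_assoc]
      rw [h1.eq, h2.left_comm, h3.left_comm, h5.left_comm, hcomm.eq]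
    · by_cases hb : z ∈ b
      · obtain ⟨h1, h2⟩ := c1 a ha
        obtain ⟨h3, h4⟩ := c2 a (by tauto)
        obtain ⟨h5, h6⟩ := c2 b (by tauto)
        left
        simp only [mul_assoc]
        rw [← h1.left_comm, ← h6.left_comm, ← h2.left_comm, ← h4.left_comm, ← hcomm.left_comm]
      · obtain ⟨h1, h2⟩ := c1 a ha
        obtain ⟨h3, h4⟩ := c1 b hb
        right; right; right
        simp only [mul_assoc]
        rw [h3.eq, ← h2.left_comm]
  · rw [rev_last]
    set s := simple (first n)
    set t := simple (last n)
    by_cases ha : z.rev ∈ a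
    · obtain ⟨h1, h2⟩ := c2 b (by tauto)
      obtain ⟨h3, h4⟩ := c1 a (by tauto)
      obtain ⟨h5, h6⟩ := c1 b (by tauto)
      right; left
      simp only [mul_assoc]
      rw [h1.eq, h2.left_comm, h3.left_comm, h5.left_comm]
    · by_cases hb : z.rev ∈ b
      · obtain ⟨h1, h2⟩ := c2 a ha
        obtain ⟨h3, h4⟩ := c1 a (by tauto)
        obtain ⟨h5, h6⟩ := c1 b (by tauto)
        left
        simp only [mul_assoc]
        rw [← h1.left_comm, ← h6.left_comm, ← h2.left_comm, ← h4.left_comm]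
      · obtain ⟨h1, h2⟩ := c2 a ha
        obtain ⟨h3, h4⟩ := c2 b hb
        right; right; left
        simp only [mul_assoc]
        rw [h3.eq, ← h2.left_comm]

/-! ### Admissible elements as doubles of half words -/

theorem exists_map_shift {n : ℕ} (l : List (Fin (n + 2 - 1))) (h0 : first n ∉ l)
    (h1 : last n ∉ l) : ∃ l' : List (Fin (n - 1)), l = l'.map shift := by
  induction l with
  | nil => exact ⟨[], rfl⟩
  | cons i l ih =>
    rw [List.mem_cons, not_or] at h0 h1
    obtain ⟨l', rfl⟩ := ih h0.2 h1.2
    rcases eq_first_or_last_or_shift i with h | h | ⟨j, rfl⟩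
    · exact absurd h.symm h0.1
    · exact absurd h.symm h1.1
    · exact ⟨j :: l', rfl⟩

theorem IsHalfWord.abs_height_double_le {n : ℕ} (hn : 2 ≤ n) {l : List (Fin (n - 1))}
    (hl : IsHalfWord l) : |height (double l)| ≤ 1 := by
  rw [hl.height_double hn]
  split_ifs <;> simp

/-- Exactly one outer generator occurs in `l`. Deleting it leaves a half word for two letters fewer,
of whose double `double l` is an extension; the height bound holds for every half word. -/
theorem isAdmissible_double (p n : ℕ) (hn : n = 2 * p + 3) (l : List (Fin (n - 1)))
    (hl : IsHalfWord l) : IsAdmissible (double l) := by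
  induction p generalizing n with
  | zero =>
    subst hn
    have hlen : l.length = 1 := by have := hl.two_mul_length; omega
    obtain ⟨x, rfl⟩ := List.length_eq_one_iff.1 hlen
    rw [double_eq, mirror_singleton, wordProd_singleton, wordProd_singleton]
    rcases (by omega : x.val = 0 ∨ x.val = 1) with h | h
    · obtain rfl : x = (0 : Fin 2) := Fin.ext h
      exact IsAdmissible.base_right
    · obtain rfl : x = (1 : Fin 2) := Fin.ext h
      exact IsAdmissible.base_left
  | succ p ih =>
    obtain ⟨n, rfl⟩ : ∃ q, n = q + 2 := ⟨n - 2, by omega⟩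
    obtain ⟨x, hx, hxl, hxr⟩ : ∃ x, (x = first n ∨ x = last n) ∧ x ∈ l ∧ x.rev ∉ l := by
      have := hl.mem_iff (first n)
      have h2 := hl.mem_iff (last n)
      rw [rev_last] at h2
      by_cases h : first n ∈ l
      · exact ⟨_, Or.inl rfl, h, this.1 h⟩
      · exact ⟨_, Or.inr rfl, h2.2 h, by rwa [rev_last]⟩
    obtain ⟨a, b, rfl⟩ := List.append_of_mem hxl
    have hnd := (isHalfWord_iff.1 hl).1
    rw [List.nodup_middle, List.nodup_cons, List.mem_append, not_or] at hnd
    simp only [List.mem_append, List.mem_cons, not_or] at hxr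
    have hfree : (first n ∉ a ∧ last n ∉ a) ∧ (first n ∉ b ∧ last n ∉ b) := by
      rcases hx with rfl | rfl
      · rw [rev_first] at hxr; tauto
      · rw [rev_last] at hxr; tauto
    obtain ⟨a, rfl⟩ := exists_map_shift a hfree.1.1 hfree.1.2
    obtain ⟨b, rfl⟩ := exists_map_shift b hfree.2.1 hfree.2.2
    have hl' : IsHalfWord (a ++ b) := by
      rwa [isHalfWord_perm List.perm_middle, ← List.map_append,
        isHalfWord_cons_map_shift (by omega) hx] at hl
    exact IsAdmissible.extension (ih n (by omega) _ hl') (isExtension_double (by omega) hl' hx)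
      (hl.abs_height_double_le (by omega))

/-- Prepending or appending an outer generator to `l` realizes every extension except the one that
pushes the height from `±1` to `±3`. -/
theorem IsAdmissible.exists_halfWord {n : ℕ} {C : Perm (Fin n)} (hC : IsAdmissible C) :
    3 ≤ n ∧ ∃ l : List (Fin (n - 1)), IsHalfWord l ∧ C = double l := by
  induction hC with
  | base_left =>
    refine ⟨le_rfl, [(1 : Fin 2)], isHalfWord_iff.2 ⟨List.nodup_singleton _, by decide⟩, ?_⟩
    rw [double_eq, mirror_singleton, wordProd_singleton, wordProd_singleton]
    rfl
  | base_right =>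
    refine ⟨le_rfl, [(0 : Fin 2)], isHalfWord_iff.2 ⟨List.nodup_singleton _, by decide⟩, ?_⟩
    rw [double_eq, mirror_singleton, wordProd_singleton, wordProd_singleton]
    rfl
  | @extension n C D _ hD hht ih =>
    obtain ⟨hn, l, hl, rfl⟩ := ih
    refine ⟨by omega, ?_⟩
    have hn' : 2 ≤ n := by omega
    have hcomm := commute_first_last hn'
    have hheight := hl.height_double hn'
    obtain ⟨hup, hdown⟩ := hl.isCoxeterWord.height_extension hn'
    have hcons : ∀ x, x = first n ∨ x = last n →
        IsHalfWord (x :: l.map shift) ∧ IsHalfWord (l.map shift ++ [x]) := fun x hx => by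
      have h := (isHalfWord_cons_map_shift hn' hx).2 hl
      exact ⟨h, (isHalfWord_perm (List.perm_append_singleton _ _)).2 h⟩
    have hdc : ∀ x : Fin (n + 2 - 1), double (x :: l.map shift) =
        simple x.rev * wordProd ((mirror l).map shift) * (simple x * wordProd (l.map shift)) := by
      intro x
      rw [double_eq, wordProd_cons, mirror_cons, wordProd_cons, mirror_map_shift]
    have hda : ∀ x : Fin (n + 2 - 1), double (l.map shift ++ [x]) =
        wordProd ((mirror l).map shift) * simple x.rev * (wordProd (l.map shift) * simple x) := by
      intro x
      rw [double_eq, wordProd_append, mirror_append, wordProd_append, mirror_map_shift,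
        wordProd_singleton, mirror_singleton, wordProd_singleton]
    rw [IsExtension, bar_double] at hD
    rw [bar_double] at hup hdown
    change _ = simple (first n) * simple (last n) * _ ∨
      _ = _ * simple (first n) * simple (last n) ∨
      _ = simple (first n) * _ * simple (last n) ∨
      _ = simple (last n) * _ * simple (first n) at hD
    change height (simple (last n) * _ * simple (first n)) = _ at hup
    change height (simple (first n) * _ * simple (last n)) = _ at hdown
    set A := wordProd ((mirror l).map shift) with hA
    set B := wordProd (l.map shift) with hB
    set s := simple (first n) with hs
    set t := simple (last n) with ht
    set z : Fin (n - 1) := ⟨0, by omega⟩ with hzdef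
    have hz : z.rev.val = n - 2 := by simp only [z, Fin.val_rev]; omega
    have hzm := hl.mem_iff z
    obtain ⟨hf1, hf2⟩ := hcons _ (Or.inl rfl)
    obtain ⟨hl1, hl2⟩ := hcons _ (Or.inr rfl)
    have df1 := hdc (first n)
    have df2 := hda (first n)
    have dl1 := hdc (last n)
    have dl2 := hda (last n)
    rw [rev_first, ← hs, ← ht] at df1 df2
    rw [rev_last, ← hs, ← ht] at dl1 dl2
    -- If `z ∈ l`, the height is `1` and the extension `t * _ * s` is excluded; otherwise the height
    -- is `-1` and `s * _ * t` is excluded.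
    by_cases hzl : z ∈ l
    · have hc1 : Commute s A := commute_first fun i hi h => by
        rw [mem_mirror, show i = z from Fin.ext h] at hi
        exact hzm.1 hzl hi
      have hc2 : Commute t B := commute_last fun i hi h => by
        rw [show i = z.rev from Fin.ext (h.trans hz.symm)] at hi
        exact hzm.1 hzl hi
      rw [if_pos hzl] at hheight
      rcases hD with rfl | rfl | rfl | rfl
      · refine ⟨_, hf1, df1.symm ▸ ?_⟩
        simp only [mul_assoc]
        rw [← hc1.left_comm, hcomm.left_comm]
      · refine ⟨_, hf2, df2.symm ▸ ?_⟩
        simp only [mul_assoc]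
        rw [hc2.left_comm, hcomm.eq]
      · refine ⟨_, hl1, dl1.symm ▸ ?_⟩
        simp only [mul_assoc]
        rw [hc2.eq]
      · rw [hup, hheight] at hht
        norm_num at hht
    · have hzr : z.rev ∈ l := by rwa [hl.mem_iff, Fin.rev_rev]
      have hc1 : Commute s B := commute_first fun i hi h => by
        rw [show i = z from Fin.ext h] at hi
        exact hzl hi
      have hc2 : Commute t A := commute_last fun i hi h => by
        rw [mem_mirror, show i = z.rev from Fin.ext (h.trans hz.symm), Fin.rev_rev] at hi
        exact hzl hi
      rw [if_neg hzl] at hheight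
      rcases hD with rfl | rfl | rfl | rfl
      · refine ⟨_, hl1, dl1.symm ▸ ?_⟩
        simp only [mul_assoc]
        rw [← hc2.left_comm]
      · refine ⟨_, hl2, dl2.symm ▸ ?_⟩
        simp only [mul_assoc]
        rw [hc1.left_comm]
      · rw [hdown, hheight] at hht
        norm_num at hht
      · refine ⟨_, hf1, df1.symm ▸ ?_⟩
        simp only [mul_assoc]
        rw [hc1.eq]

end CoxeterAdmissible

theorem theorem4p3 (m : ℕ) (hm : 2 ≤ m) (C : Equiv.Perm (Fin (2 * m - 1)))
    (hC : CoxeterAdmissible.IsCoxeterElement C) :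
    CoxeterAdmissible.IsAdmissible C ↔
      ∃ w₁ w₂ : Equiv.Perm (Fin (2 * m - 1)),
        CoxeterAdmissible.length w₁ = m - 1 ∧ CoxeterAdmissible.length w₂ = m - 1 ∧
          C = w₁ * w₂ ∧ CoxeterAdmissible.IsLongest (w₂ * C ^ (m - 1)) := by
  rw [CoxeterAdmissible.exists_factorization_iff (by omega) hC]
  constructor
  · exact fun h => h.exists_halfWord.2
  · rintro ⟨l, hl, rfl⟩
    exact CoxeterAdmissible.isAdmissible_double (m - 2) _ (by omega) l hl
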